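/- Fix $K\ge 2$ arms $[K]=\{1,\dots,K\}$ and standard deviations $\sigma^a>0$, $a\in[K]$ (known to the decision-maker and the same for all Gaussian instances below). An instance is a joint law $P$ of $K$ real potential outcomes $(Y^1,\dots,Y^K)$ with finite means $\mu^a(P)=\mathbb{E}_P[Y^a]$ and a unique best arm $a^*(P)=\arg\max_{a\in[K]}\mu^a(P)$. Let $\mathcal{G}_\sigma$ be the set of the instances that are multivariate Gaussian with $Y^a\sim\mathcal{N}(\mu^a(P),(\sigma^a)^2)$ for all $a$, and let \[\mathcal{P}^{\mathrm{G}}(a^*,\underline\Delta,\overline\Delta)=\{P\in\mathcal{G}_\sigma : a^*(P)=a^*,\ \underline\Delta\le\mu^{a^*}(P)-\mu^a(P)\le\overline\Delta\ \text{ for all } a\ne a^*\}.\] A strategy $\pi$ consists, for every budget $T$, of an allocation rule, which chooses the arm $A_t\in[K]$ of round $t\in[T]$ as a measurable function of $(A_s,Y_s)_{s<t}$, and a recommendation rule, which chooses $\widehat a^\pi_T\in[K]$ as a measurable function of $(A_s,Y_s)_{s\le T}$. Here $Y_t=Y_t^{A_t}$ and the vectors $(Y^1_t,\dots,Y^K_t)$,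 $t=1,2,\dots$, are i.i.d. with law $P$; the resulting probability and expectation are written $\mathbb{P}_P$ and $\mathbb{E}_P$. Let $\mathcal{P}$ be a class of instances with $\mathcal{G}_\sigma\subseteq\mathcal{P}$ (for example, the class of all instances), and let $\mathcal{W}=\{w:[K]\to(0,1) : \sum_{a}w(a)=1\}$. A strategy $\pi$ is consistent if $\mathbb{P}_P(\widehat a^\pi_T=a^*(P))\to1$ as $T\to\infty$ for every $P\in\mathcal{P}$. It is asymptotically invariant if there is $w^\pi\in\mathcal{W}$ such that $\mathbb{E}_P\big[\frac1T\sum_{t=1}^T\mathbf{1}[A_t=a]\big]\to w^\pi(a)$ as $T\to\infty$ for every $P\in\mathcal{P}$ and every $a\in[K]$. Theorem (best-arm-worst-case lower bound). Let $0<\underline\Delta\le\overline\Delta<\infty$. Then the maximum \[\mathrm{LowerBound}(\overline\Delta)=\max_{w\in\mathcal{W}}\ \min_{a^*\in[K]}\ \min_{a\in[K]\setminus\{a^*\}}\frac{\overline\Delta^2}{2\,\Omega^{a^*,a}(w)},\qquad \Omega^{a^*,a}(w)=\frac{(\sigma^{a^*})^2}{w(a^*)}+\frac{(\sigma^a)^2}{w(a)},\]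 exists, and every consistent and asymptotically invariant strategy $\pi$ satisfies \[\inf_{P\in\bigcup_{a^*\in[K]}\mathcal{P}^{\mathrm{G}}(a^*,\underline\Delta,\overline\Delta)}\ \limsup_{T\to\infty}\ -\frac1T\log\mathbb{P}_P\big(\widehat a^\pi_T\ne a^*(P)\big)\ \le\ \mathrm{LowerBound}(\overline\Delta),\] where $-\log 0=+\infty$. -/

import Mathlib

open MeasureTheory ProbabilityTheory Filter Topology

namespace FixedBudgetBAI

/-- A bandit instance with arms `Fin K`: a joint law of the `K` potential outcomes, with finite
means, whose best arm (the arm with the largest mean) is unique. -/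
structure BanditInstance (K : ℕ) where
  law : Measure (Fin K → ℝ)
  isProbabilityMeasure : IsProbabilityMeasure law
  integrable : ∀ a, Integrable (fun y : Fin K → ℝ => y a) law
  exists_best : ∃ a, ∀ b, b ≠ a → ∫ y, y b ∂law < ∫ y, y a ∂law

attribute [instance] BanditInstance.isProbabilityMeasure

/-- The expected outcome of arm `a`. -/
noncomputable def BanditInstance.mean {K : ℕ} (P : BanditInstance K) (a : Fin K) : ℝ :=
  ∫ y, y a ∂P.law

/-- The best arm. -/
noncomputable def BanditInstance.bestArm {K : ℕ} (P : BanditInstance K) : Fin K :=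
  P.exists_best.choose

theorem BanditInstance.mean_lt_mean_bestArm {K : ℕ} (P : BanditInstance K) {b : Fin K}
    (hb : b ≠ P.bestArm) : P.mean b < P.mean P.bestArm :=
  P.exists_best.choose_spec b hb

/-- All multivariate Gaussian instances with the given standard deviations `σ` (and a unique best
arm). -/
def gaussianClass {K : ℕ} (σ : Fin K → ℝ) : Set (BanditInstance K) :=
  {P | IsGaussian P.law ∧
    ∀ a, P.law.map (fun y => y a) = gaussianReal (P.mean a) (Real.toNNReal (σ a ^ 2))}

/-- The Gaussian bandit model with standard deviations `σ` and best arm `aStar`, in which all gaps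
between the best arm and another arm lie in `[Δl, Δu]`. -/
def gaussianModel {K : ℕ} (σ : Fin K → ℝ) (aStar : Fin K) (Δl Δu : ℝ) :
    Set (BanditInstance K) :=
  {P | P ∈ gaussianClass σ ∧ P.bestArm = aStar ∧
    ∀ a, a ≠ aStar → Δl ≤ P.mean aStar - P.mean a ∧ P.mean aStar - P.mean a ≤ Δu}

/-- A strategy: for every budget `T`, an allocation rule, which chooses the arm of each round
(rounds are numbered `0, …, T - 1`) as a measurable function of the pairs (arm, outcome) of the
earlier rounds, and a recommendation rule, which is a measurable function of the pairs of all `T`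
rounds. -/
structure Strategy (K : ℕ) where
  alloc : (T t : ℕ) → (Fin t → Fin K × ℝ) → Fin K
  measurable_alloc : ∀ T t, Measurable (alloc T t)
  recommend : (T : ℕ) → (Fin T → Fin K × ℝ) → Fin K
  measurable_recommend : ∀ T, Measurable (recommend T)

/-- The pairs (arm, outcome) observed in the first `t` rounds, for the budget `T`, when the
potential outcomes are `ω`: in each round only the outcome of the allocated arm is observed. -/
def Strategy.history {K : ℕ} (π : Strategy K) (T : ℕ) (ω : ℕ → Fin K → ℝ) :
    (t : ℕ) → Fin t → Fin K × ℝ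
  | 0 => Fin.elim0
  | t + 1 =>
    Fin.snoc (α := fun _ => Fin K × ℝ) (π.history T ω t)
      (π.alloc T t (π.history T ω t), ω t (π.alloc T t (π.history T ω t)))

/-- The arm allocated in round `t`, for the budget `T`. -/
def Strategy.arm {K : ℕ} (π : Strategy K) (T : ℕ) (ω : ℕ → Fin K → ℝ) (t : ℕ) : Fin K :=
  π.alloc T t (π.history T ω t)

/-- The arm recommended at the end of the experiment with budget `T`. -/
def Strategy.recommended {K : ℕ} (π : Strategy K) (T : ℕ) (ω : ℕ → Fin K → ℝ) : Fin K :=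
  π.recommend T (π.history T ω T)

/-- The law of the potential outcomes of all rounds, which are i.i.d. copies of those of `P`. -/
noncomputable def BanditInstance.seqLaw {K : ℕ} (P : BanditInstance K) :
    Measure (ℕ → Fin K → ℝ) :=
  Measure.infinitePi (fun _ : ℕ => P.law)

/-- The probability of misidentification for the budget `T`. -/
noncomputable def errorProb {K : ℕ} (π : Strategy K) (P : BanditInstance K) (T : ℕ) : ENNReal :=
  P.seqLaw {ω | π.recommended T ω ≠ P.bestArm}

/-- The average sample allocation ratio of arm `a` for the budget `T`. -/
noncomputable def allocRatio {K : ℕ} (π : Strategy K) (P : BanditInstance K) (T : ℕ)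
    (a : Fin K) : ℝ :=
  ∫ ω, (1 / (T : ℝ)) * ∑ t ∈ Finset.range T, (if π.arm T ω t = a then 1 else 0) ∂P.seqLaw

/-- The simplex of allocation ratios with all entries in the open interval `(0, 1)`. -/
def allocSimplex (K : ℕ) : Set (Fin K → ℝ) :=
  {w | (∀ a, 0 < w a ∧ w a < 1) ∧ ∑ a, w a = 1}

/-- Consistency over a class `M` of instances. -/
def IsConsistent {K : ℕ} (M : Set (BanditInstance K)) (π : Strategy K) : Prop :=
  ∀ P ∈ M, Tendsto (fun T : ℕ => P.seqLaw {ω | π.recommended T ω = P.bestArm}) atTop (𝓝 1)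

/-- Asymptotic invariance over a class `M` of instances: the average sample allocation ratio
converges to a limit that is the same for all instances in `M`. -/
def IsAsympInvariant {K : ℕ} (M : Set (BanditInstance K)) (π : Strategy K) : Prop :=
  ∃ w ∈ allocSimplex K, ∀ P ∈ M, ∀ a,
    Tendsto (fun T : ℕ => allocRatio π P T a) atTop (𝓝 (w a))

/-- `limsup_T -(1/T) log P(misidentification)`, in the extended reals: the value is `⊤` where the
probability is `0`. -/
noncomputable def errorExponent {K : ℕ} (π : Strategy K) (P : BanditInstance K) : EReal :=
  limsup (fun T : ℕ => ((-(1 / (T : ℝ)) : ℝ) : EReal) * ENNReal.log (errorProb π P T)) atTop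

/-- `Ω^{a,b}(w)`. -/
noncomputable def pairVariance {K : ℕ} (σ : Fin K → ℝ) (w : Fin K → ℝ) (a b : Fin K) : ℝ :=
  σ a ^ 2 / w a + σ b ^ 2 / w b

/-- `min_{a*} min_{a ≠ a*} Δ² / (2 Ω^{a*,a}(w))`. -/
noncomputable def worstPair {K : ℕ} (σ : Fin K → ℝ) (Δ : ℝ) (w : Fin K → ℝ) : ℝ :=
  ⨅ aStar : Fin K, ⨅ a : {a : Fin K // a ≠ aStar}, Δ ^ 2 / (2 * pairVariance σ w aStar a)

/-- `LowerBound(Δ)`, the supremum of `worstPair σ Δ` over the simplex. -/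
noncomputable def lowerBound {K : ℕ} (σ : Fin K → ℝ) (Δ : ℝ) : ℝ :=
  sSup (worstPair σ Δ '' allocSimplex K)

end FixedBudgetBAI

open FixedBudgetBAI

namespace FixedBudgetBAI

variable {K : ℕ}

/-! The bound is a change-of-measure argument. Let `Q` have another best arm than `P`. Consistency
makes recommending the best arm of `Q` asymptotically certain under `Q`, whereas under `P` it is an
error. Since only the allocated arm is observed, the log-likelihood ratio of the histories is a sum
over rounds of one-arm ratios (`Strategy.lintegral_history_eq`), and by Wald's identity
(`Strategy.integral_histSum`) its mean per round is governed by the allocation ratios under `Q`. A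
Jensen-type estimate (`mul_exp_le_setLIntegral_exp`) then bounds the error exponent at `P` by `∑ a,
w a * KL(Q_a, P_a)` (`errorExponent_le`).

Asymptotic invariance makes `w` the same for every `Q`, so it can be fixed first. For the Gaussian
`P` with best arm `a` and all gaps equal to `Δ`, the cheapest way to let `b` overtake `a` moves only
these two means and costs `Δ ^ 2 / (2 * pairVariance σ w a b)` in the limit
(`errorExponent_slopeMean_le`). Taking `(a, b)` minimal for `w` gives `worstPair σ Δ w`, which is at
most the maximum over the simplex; that maximum is attained by compactness
(`isGreatest_lowerBound`). -/

instance (P : BanditInstance K) : IsProbabilityMeasure P.seqLaw := by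
  unfold BanditInstance.seqLaw; infer_instance

/-! ### Measurability of histories and independence from the current round. -/

theorem measurable_snoc {α : Type*} [MeasurableSpace α] (t : ℕ) :
    Measurable (fun p : (Fin t → α) × α => Fin.snoc (α := fun _ => α) p.1 p.2) := by
  refine measurable_pi_iff.2 fun i => ?_
  induction i using Fin.lastCases with
  | last => simpa using measurable_snd
  | cast i => simpa [Function.comp_def] using (measurable_pi_apply i).comp measurable_fst

theorem Strategy.measurable_snoc_alloc (π : Strategy K) (T t : ℕ) :
    Measurable (fun p : (Fin t → Fin K × ℝ) × (Fin K → ℝ) =>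
      Fin.snoc (α := fun _ => Fin K × ℝ) p.1 (π.alloc T t p.1, p.2 (π.alloc T t p.1))) := by
  have h1 : Measurable fun p : (Fin t → Fin K × ℝ) × (Fin K → ℝ) => π.alloc T t p.1 :=
    (π.measurable_alloc T t).comp measurable_fst
  have h2 : Measurable fun q : Fin K × (Fin K → ℝ) => q.2 q.1 :=
    measurable_from_prod_countable_right fun a => measurable_pi_apply a
  exact (measurable_snoc t).comp
    (measurable_fst.prodMk (h1.prodMk (h2.comp (h1.prodMk measurable_snd))))

theorem Strategy.measurable_history (π : Strategy K) (T t : ℕ) :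
    Measurable (fun ω => π.history T ω t) := by
  induction t with
  | zero => exact measurable_pi_iff.2 fun i => i.elim0
  | succ t ih => exact (π.measurable_snoc_alloc T t).comp (ih.prodMk (measurable_pi_apply t))

theorem Strategy.measurable_arm (π : Strategy K) (T t : ℕ) :
    Measurable (fun ω => π.arm T ω t) :=
  (π.measurable_alloc T t).comp (π.measurable_history T t)

theorem Strategy.measurable_recommended (π : Strategy K) (T : ℕ) :
    Measurable (fun ω => π.recommended T ω) :=
  (π.measurable_recommend T).comp (π.measurable_history T T)

/-- The history up to round `t` depends only on the outcomes of the earlier rounds. -/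
theorem Strategy.history_congr (π : Strategy K) (T : ℕ) {ω ω' : ℕ → Fin K → ℝ} {t : ℕ}
    (h : ∀ s < t, ω s = ω' s) : π.history T ω t = π.history T ω' t := by
  induction t with
  | zero => rfl
  | succ t ih =>
    simp only [Strategy.history, ih fun s hs => h s (hs.trans t.lt_succ_self), h t t.lt_succ_self]

theorem Strategy.indepFun_history (π : Strategy K) (P : BanditInstance K) (T t : ℕ) :
    IndepFun (fun ω => π.history T ω t) (fun ω => ω t) P.seqLaw := by
  have h : iIndepFun (fun (i : ℕ) (ω : ℕ → Fin K → ℝ) => ω i) P.seqLaw :=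
    iIndepFun_infinitePi (P := fun _ : ℕ => P.law) (X := fun _ x => x) fun _ => measurable_id
  have h2 := h.indepFun_finset (Finset.range t) {t} (by simp) fun i => measurable_pi_apply i
  -- Pads the first `t` outcome vectors with zeros to a full sequence; by `history_congr` the
  -- padding does not affect the history.
  let e : (Finset.range t → Fin K → ℝ) → ℕ → Fin K → ℝ :=
    fun x s => if hs : s ∈ Finset.range t then x ⟨s, hs⟩ else 0
  have he : Measurable e := by
    refine measurable_pi_iff.2 fun s => ?_
    by_cases hs : s ∈ Finset.range t
    · simpa only [e, hs, dif_pos] using measurable_pi_apply _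
    · simpa only [e, hs, dif_neg, not_false_iff] using measurable_const
  have h3 := h2.comp ((π.measurable_history T t).comp he)
    (measurable_pi_apply (⟨t, Finset.mem_singleton_self t⟩ : ({t} : Finset ℕ)))
  have e1 : (fun ω => π.history T ω t)
      = ((fun ω => π.history T ω t) ∘ e) ∘ fun ω (i : Finset.range t) => ω i := by
    ext1 ω
    refine π.history_congr T fun s hs => ?_
    simp [e, hs]
  rw [e1]
  exact h3

theorem BanditInstance.map_seqLaw (P : BanditInstance K) (t : ℕ) :
    P.seqLaw.map (fun ω => ω t) = P.law :=
  Measure.infinitePi_map_eval (fun _ : ℕ => P.law) t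

/-- By independence of past and present, Tonelli integrates out the current outcome with the past
frozen; this drives the induction on rounds below. -/
theorem Strategy.lintegral_history (π : Strategy K) (P : BanditInstance K) (T t : ℕ)
    {f : (Fin t → Fin K × ℝ) × (Fin K → ℝ) → ENNReal} (hf : Measurable f) :
    ∫⁻ ω, f (π.history T ω t, ω t) ∂P.seqLaw
      = ∫⁻ ω, ∫⁻ y, f (π.history T ω t, y) ∂P.law ∂P.seqLaw := by
  have hm := π.measurable_history T t
  have h := (indepFun_iff_map_prod_eq_prod_map_map hm.aemeasurable
    (measurable_pi_apply t).aemeasurable).1 (π.indepFun_history P T t)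
  rw [P.map_seqLaw] at h
  rw [← lintegral_map (g := fun ω => (π.history T ω t, ω t)) hf
    (hm.prodMk (measurable_pi_apply t)), h, lintegral_prod _ hf.aemeasurable,
    lintegral_map (f := fun h => ∫⁻ y, f (h, y) ∂P.law) hf.lintegral_prod_right' hm]

/-! ### Likelihood ratios of histories and Wald's identity. -/

/-- The sum of `ℓ` over the pairs (arm, outcome) of a history. -/
def histSum (ℓ : Fin K → ℝ → ℝ) {t : ℕ} (h : Fin t → Fin K × ℝ) : ℝ :=
  ∑ i, ℓ (h i).1 (h i).2

theorem measurable_histSum {ℓ : Fin K → ℝ → ℝ} (hℓ : ∀ a, Measurable (ℓ a)) (t : ℕ) :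
    Measurable (histSum ℓ (t := t)) := by
  have h : Measurable fun p : Fin K × ℝ => ℓ p.1 p.2 := measurable_from_prod_countable_right hℓ
  exact Finset.measurable_sum _ fun i _ => h.comp (measurable_pi_apply i)

theorem histSum_snoc (ℓ : Fin K → ℝ → ℝ) {t : ℕ} (h : Fin t → Fin K × ℝ) (p : Fin K × ℝ) :
    histSum ℓ (Fin.snoc (α := fun _ => Fin K × ℝ) h p) = histSum ℓ h + ℓ p.1 p.2 := by
  simp [histSum, Fin.sum_univ_castSucc]

theorem histSum_history (ℓ : Fin K → ℝ → ℝ) (π : Strategy K) (T t : ℕ) (ω : ℕ → Fin K → ℝ) :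
    histSum ℓ (π.history T ω t)
      = ∑ s ∈ Finset.range t, ℓ (π.arm T ω s) (ω s (π.arm T ω s)) := by
  induction t with
  | zero => simp [histSum]
  | succ t ih => rw [Strategy.history, histSum_snoc, ih, Finset.sum_range_succ]; rfl

/-- Change of measure for histories. -/
theorem Strategy.lintegral_history_eq (π : Strategy K) {P Q : BanditInstance K}
    {ℓ : Fin K → ℝ → ℝ} (hℓ : ∀ a, Measurable (ℓ a))
    (hPQ : ∀ a, P.law.map (fun y => y a)
      = (Q.law.map (fun y => y a)).withDensity fun x => ENNReal.ofReal (Real.exp (ℓ a x)))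
    (T t : ℕ) {F : (Fin t → Fin K × ℝ) → ENNReal} (hF : Measurable F) :
    ∫⁻ ω, F (π.history T ω t) ∂P.seqLaw
      = ∫⁻ ω, ENNReal.ofReal (Real.exp (histSum ℓ (π.history T ω t))) * F (π.history T ω t)
          ∂Q.seqLaw := by
  induction t with
  | zero =>
    have h : ∀ ω, π.history T ω 0 = Fin.elim0 := fun _ => rfl
    simp [h, histSum]
  | succ t ih =>
    have hs := π.measurable_snoc_alloc T t
    have hFs := hF.comp hs
    have hL : ∀ s, Measurable fun h : Fin s → Fin K × ℝ =>
        ENNReal.ofReal (Real.exp (histSum ℓ h)) := fun s =>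
      (Real.measurable_exp.comp (measurable_histSum hℓ s)).ennreal_ofReal
    have key := π.lintegral_history P T t hFs
    have key2 := π.lintegral_history Q T t (((hL (t + 1)).comp hs).mul hFs)
    simp only [Function.comp_def, Pi.mul_apply] at key key2 hFs
    simp only [Strategy.history]
    -- The induction hypothesis is applied to `F` with the last round already averaged under `P`.
    rw [key, key2, ih (F := fun h => ∫⁻ y, F (Fin.snoc (α := fun _ => Fin K × ℝ) h
      (π.alloc T t h, y (π.alloc T t h))) ∂P.law) hFs.lintegral_prod_right']
    refine lintegral_congr fun ω => ?_
    set h := π.history T ω t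
    set a := π.alloc T t h
    have hG : Measurable fun x : ℝ => F (Fin.snoc (α := fun _ => Fin K × ℝ) h (a, x)) :=
      hF.comp ((measurable_snoc t).comp
        (measurable_const.prodMk (measurable_const.prodMk measurable_id)))
    have hE : Measurable fun x : ℝ => ENNReal.ofReal (Real.exp (ℓ a x)) :=
      (Real.measurable_exp.comp (hℓ a)).ennreal_ofReal
    -- With the past frozen the arm `a` is fixed and only coordinate `a` enters, so the one-arm
    -- density suffices whatever the dependence between arms.
    have e1 : ∫⁻ y, F (Fin.snoc (α := fun _ => Fin K × ℝ) h (a, y a)) ∂P.law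
        = ∫⁻ y, ENNReal.ofReal (Real.exp (ℓ a (y a))) *
            F (Fin.snoc (α := fun _ => Fin K × ℝ) h (a, y a)) ∂Q.law := by
      rw [← lintegral_map (g := fun y : Fin K → ℝ => y a) hG (measurable_pi_apply a), hPQ,
        lintegral_withDensity_eq_lintegral_mul _ hE hG,
        lintegral_map (hE.mul hG) (measurable_pi_apply a)]
      rfl
    rw [e1, ← lintegral_const_mul]
    · refine lintegral_congr fun y => ?_
      rw [histSum_snoc, Real.exp_add, ENNReal.ofReal_mul (Real.exp_pos _).le, mul_assoc]
    · exact (hE.mul hG).comp (measurable_pi_apply a)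

/-- The choice of arm depends on the past alone, hence is independent of the outcome of the round.
-/
theorem Strategy.integrable_indicator_mul (π : Strategy K) (Q : BanditInstance K) (T t : ℕ)
    {a : Fin K} {g : ℝ → ℝ} (hgm : Measurable g) (hg : Integrable (fun y => g (y a)) Q.law) :
    Integrable (fun ω => (if π.arm T ω t = a then (1 : ℝ) else 0) * g (ω t a)) Q.seqLaw ∧
      ∫ ω, (if π.arm T ω t = a then (1 : ℝ) else 0) * g (ω t a) ∂Q.seqLaw
        = (∫ ω, (if π.arm T ω t = a then (1 : ℝ) else 0) ∂Q.seqLaw)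
          * ∫ y, g (y a) ∂Q.law := by
  have hgam : Measurable fun y : Fin K → ℝ => g (y a) := hgm.comp (measurable_pi_apply a)
  have hI : Measurable fun h => if π.alloc T t h = a then (1 : ℝ) else 0 :=
    Measurable.ite (π.measurable_alloc T t (measurableSet_singleton a)) measurable_const
      measurable_const
  have hind := (π.indepFun_history Q T t).comp hI hgam
  have hI' := hI.comp (π.measurable_history T t)
  have h1 : Integrable (fun ω => if π.arm T ω t = a then (1 : ℝ) else 0) Q.seqLaw :=
    Integrable.of_bound hI'.aestronglyMeasurable 1
      (ae_of_all _ fun ω => by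
        show ‖if π.arm T ω t = a then (1 : ℝ) else 0‖ ≤ 1
        split_ifs <;> simp)
  have hg' := hg
  rw [← Q.map_seqLaw t] at hg'
  have h2 : Integrable (fun ω => g (ω t a)) Q.seqLaw :=
    hg'.comp_measurable (f := fun ω : ℕ → Fin K → ℝ => ω t) (measurable_pi_apply t)
  refine ⟨hind.integrable_mul h1 h2, ?_⟩
  have h3 := hind.integral_mul_eq_mul_integral h1.aestronglyMeasurable h2.aestronglyMeasurable
  have h4 : ∫ y, g (y a) ∂Q.law = ∫ ω, g (ω t a) ∂Q.seqLaw := by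
    conv_lhs => rw [← Q.map_seqLaw t]
    exact integral_map (measurable_pi_apply t).aemeasurable hgam.aestronglyMeasurable
  rw [h4]
  exact h3

/-- Wald's identity for the sum of `ℓ` over a history. -/
theorem Strategy.integral_histSum (π : Strategy K) (Q : BanditInstance K) (T : ℕ)
    {ℓ : Fin K → ℝ → ℝ} (hℓm : ∀ a, Measurable (ℓ a))
    (hℓ : ∀ a, Integrable (fun y => ℓ a (y a)) Q.law) :
    Integrable (fun ω => histSum ℓ (π.history T ω T)) Q.seqLaw ∧
      ∫ ω, histSum ℓ (π.history T ω T) ∂Q.seqLaw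
        = T * ∑ a, allocRatio π Q T a * ∫ y, ℓ a (y a) ∂Q.law := by
  have e : ∀ ω, histSum ℓ (π.history T ω T) = ∑ s ∈ Finset.range T, ∑ a,
      (if π.arm T ω s = a then (1 : ℝ) else 0) * ℓ a (ω s a) := fun ω => by
    simp [histSum_history]
  have key := fun s a => π.integrable_indicator_mul Q T s (hℓm a) (hℓ a)
  have key1 := fun s a => (π.integrable_indicator_mul Q T s (a := a) (g := fun _ => 1)
    measurable_const (integrable_const _)).1
  simp only [mul_one] at key1
  simp only [e]
  refine ⟨integrable_finsetSum _ fun s _ => integrable_finsetSum _ fun a _ => (key s a).1, ?_⟩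
  rw [integral_finsetSum _ fun s _ => integrable_finsetSum _ fun a _ => (key s a).1,
    Finset.sum_congr rfl fun s _ => (integral_finsetSum _ fun a _ => (key s a).1),
    Finset.sum_comm, Finset.mul_sum]
  refine Finset.sum_congr rfl fun a _ => ?_
  rw [Finset.sum_congr rfl fun s _ => (key s a).2, ← Finset.sum_mul, allocRatio,
    integral_const_mul, integral_finsetSum _ fun s _ => key1 s a, ← mul_assoc, ← mul_assoc]
  rcases eq_or_ne T 0 with rfl | hT
  · simp
  · field_simp

/-! ### The transportation inequality. -/

/-- A lower bound for the probability of an event under `ν = exp(S) μ`, in terms of its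
probability under `μ` and the expectation of `-S`. -/
theorem mul_exp_le_setLIntegral_exp {Ω : Type*} [MeasurableSpace Ω] {μ : Measure Ω}
    [IsProbabilityMeasure μ] {S : Ω → ℝ} (hS : Integrable S μ)
    (hS1 : ∫⁻ ω, ENNReal.ofReal (Real.exp (S ω)) ∂μ = 1)
    {E : Set Ω} (hE : MeasurableSet E) (hE0 : 0 < μ.real E) :
    ENNReal.ofReal (μ.real E * Real.exp (-((1 - ∫ ω, S ω ∂μ) / μ.real E)))
      ≤ ∫⁻ ω in E, ENNReal.ofReal (Real.exp (S ω)) ∂μ := by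
  have hexp : Integrable (fun ω => Real.exp (S ω)) μ := by
    refine ⟨(Real.measurable_exp.comp_aemeasurable hS.aemeasurable).aestronglyMeasurable, ?_⟩
    rw [hasFiniteIntegral_iff_ofReal (ae_of_all _ fun ω => (Real.exp_pos _).le), hS1]
    exact ENNReal.one_lt_top
  have hexp1 : ∫ ω, Real.exp (S ω) ∂μ = 1 := by
    rw [integral_eq_lintegral_of_nonneg_ae (ae_of_all _ fun ω => (Real.exp_pos _).le)
      hexp.aestronglyMeasurable, hS1, ENNReal.toReal_one]
  rw [← ofReal_integral_eq_lintegral_ofReal hexp.integrableOn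
    (ae_of_all _ fun ω => (Real.exp_pos _).le)]
  refine ENNReal.ofReal_le_ofReal ?_
  set q := μ.real E
  -- A lower bound for the mean of `S` on `E`: by `h1` the complement contributes at most `1` to `∫
  -- S`. The tangent line of `exp` at `c` then plays the role of Jensen's inequality.
  set c := -((1 - ∫ ω, S ω ∂μ) / q) with hc
  have hcq : c * q = ∫ ω, S ω ∂μ - 1 := by rw [hc]; field_simp; ring
  have h1 : ∫ ω in Eᶜ, S ω ∂μ ≤ 1 := by
    calc ∫ ω in Eᶜ, S ω ∂μ ≤ ∫ ω in Eᶜ, Real.exp (S ω) ∂μ :=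
          integral_mono hS.integrableOn hexp.integrableOn fun ω => by
            linarith [Real.add_one_le_exp (S ω)]
      _ ≤ ∫ ω, Real.exp (S ω) ∂μ :=
          setIntegral_le_integral hexp (ae_of_all _ fun ω => (Real.exp_pos _).le)
      _ = 1 := hexp1
  have h2 := integral_add_compl hE hS
  have h3 : ∫ ω in E, Real.exp c * (S ω + (1 - c)) ∂μ ≤ ∫ ω in E, Real.exp (S ω) ∂μ := by
    refine integral_mono ((hS.integrableOn.add (integrable_const _)).const_mul _)
      hexp.integrableOn fun ω => ?_
    have := Real.add_one_le_exp (S ω - c)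
    have h4 : Real.exp (S ω) = Real.exp c * Real.exp (S ω - c) := by
      rw [← Real.exp_add]; ring_nf
    simp only [h4]
    exact mul_le_mul_of_nonneg_left (by linarith) (Real.exp_pos _).le
  refine le_trans ?_ h3
  rw [integral_const_mul, integral_add hS.integrableOn (integrable_const _), setIntegral_const,
    mul_comm q, smul_eq_mul]
  refine mul_le_mul_of_nonneg_left ?_ (Real.exp_pos _).le
  change q ≤ _ + q * (1 - c)
  nlinarith

/-- The transportation inequality: the error exponent at `P` is at most the limiting expected
log-likelihood ratio between `Q` and `P`, for every `Q` with another best arm. -/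
theorem errorExponent_le {π : Strategy K} {P Q : BanditInstance K} (hne : Q.bestArm ≠ P.bestArm)
    {w : Fin K → ℝ} (hw : ∀ a, Tendsto (fun T => allocRatio π Q T a) atTop (𝓝 (w a)))
    (hcons : Tendsto (fun T : ℕ => Q.seqLaw {ω | π.recommended T ω = Q.bestArm}) atTop (𝓝 1))
    {ℓ : Fin K → ℝ → ℝ} (hℓm : ∀ a, Measurable (ℓ a))
    (hℓ : ∀ a, Integrable (fun y => ℓ a (y a)) Q.law)
    (hPQ : ∀ a, P.law.map (fun y => y a)
      = (Q.law.map (fun y => y a)).withDensity fun x => ENNReal.ofReal (Real.exp (ℓ a x))) :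
    errorExponent π P ≤ ((∑ a, w a * -∫ y, ℓ a (y a) ∂Q.law : ℝ) : EReal) := by
  set E : ℕ → Set (ℕ → Fin K → ℝ) := fun T => {ω | π.recommended T ω = Q.bestArm}
  have hEm : ∀ T, MeasurableSet (E T) := fun T =>
    π.measurable_recommended T (measurableSet_singleton _)
  set q : ℕ → ℝ := fun T => Q.seqLaw.real (E T)
  have hq : Tendsto q atTop (𝓝 1) := by
    have := (ENNReal.tendsto_toReal ENNReal.one_ne_top).comp hcons
    rwa [ENNReal.toReal_one] at this
  set k : ℕ → ℝ := fun T => ∑ a, allocRatio π Q T a * -∫ y, ℓ a (y a) ∂Q.law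
  have hk : Tendsto k atTop (𝓝 (∑ a, w a * -∫ y, ℓ a (y a) ∂Q.law)) :=
    tendsto_finsetSum _ fun a _ => (hw a).mul_const _
  -- The bound for budget `T`: minus `1 / T` times the logarithm of the estimate in
  -- `mul_exp_le_setLIntegral_exp`. As `q T` tends to `1`, only `k T` survives in the limit.
  set b : ℕ → ℝ := fun T => ((T : ℝ)⁻¹ + k T) / q T - (T : ℝ)⁻¹ * Real.log (q T)
  have hb : Tendsto b atTop (𝓝 (∑ a, w a * -∫ y, ℓ a (y a) ∂Q.law)) := by
    have hT := tendsto_inv_atTop_nhds_zero_nat (𝕜 := ℝ)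
    have := ((hT.add hk).div hq one_ne_zero).sub (hT.mul (hq.log one_ne_zero))
    simpa using this
  have hbE : Tendsto (fun T => (b T : EReal)) atTop
      (𝓝 ((∑ a, w a * -∫ y, ℓ a (y a) ∂Q.law : ℝ) : EReal)) :=
    (continuous_coe_real_ereal.tendsto _).comp hb
  rw [← hbE.limsup_eq]
  refine limsup_le_limsup ?_
  filter_upwards [eventually_gt_atTop 0, hq.eventually (lt_mem_nhds zero_lt_one)] with T hT hqT
  obtain ⟨hSi, hSe⟩ := π.integral_histSum Q T hℓm hℓ
  have hS1 : ∫⁻ ω, ENNReal.ofReal (Real.exp (histSum ℓ (π.history T ω T))) ∂Q.seqLaw = 1 := by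
    have := π.lintegral_history_eq hℓm hPQ T T (F := fun _ => 1) measurable_const
    simpa using this.symm
  have h1 := mul_exp_le_setLIntegral_exp hSi hS1 (hEm T) hqT
  have h2 : ∫⁻ ω in E T, ENNReal.ofReal (Real.exp (histSum ℓ (π.history T ω T))) ∂Q.seqLaw
      = P.seqLaw (E T) := by
    have hR : MeasurableSet {h | π.recommend T h = Q.bestArm} :=
      π.measurable_recommend T (measurableSet_singleton _)
    have := π.lintegral_history_eq hℓm hPQ T T
      (F := Set.indicator {h | π.recommend T h = Q.bestArm} 1) (measurable_one.indicator hR)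
    rw [← lintegral_indicator (hEm T), ← lintegral_indicator_one (hEm T)]
    refine Eq.trans (lintegral_congr fun ω => ?_) this.symm
    by_cases hω : ω ∈ E T
    · have : π.history T ω T ∈ {h | π.recommend T h = Q.bestArm} := hω
      rw [Set.indicator_of_mem hω, Set.indicator_of_mem this]; simp
    · have : π.history T ω T ∉ {h | π.recommend T h = Q.bestArm} := hω
      rw [Set.indicator_of_notMem hω, Set.indicator_of_notMem this]; simp
  have h3 : P.seqLaw (E T) ≤ errorProb π P T :=
    measure_mono fun ω (hω : _ = _) => by
      simp only [Set.mem_ofPred_eq, hω]; exact hne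
  rw [h2] at h1
  have h4 := ENNReal.log_monotone (h1.trans h3)
  have hTr : (0 : ℝ) < T := Nat.cast_pos.2 hT
  rw [ENNReal.log_ofReal_of_pos (mul_pos hqT (Real.exp_pos _)),
    Real.log_mul hqT.ne' (Real.exp_pos _).ne', Real.log_exp] at h4
  have h5 : b T = -(1 / (T : ℝ)) * (Real.log (q T)
      + -((1 - ∫ ω, histSum ℓ (π.history T ω T) ∂Q.seqLaw) / q T)) := by
    simp only [b, k, hSe, mul_neg, Finset.sum_neg_distrib]
    field_simp
    ring
  rw [h5, EReal.coe_mul]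
  rw [mul_comm, mul_comm ((-(1 / (T : ℝ)) : ℝ) : EReal) (_ : EReal)]
  exact EReal.mul_le_mul_of_nonpos_right h4 (by
    exact_mod_cast (neg_nonpos.2 (by positivity) : -(1 / (T : ℝ)) ≤ 0))

/-! ### Gaussian instances with independent arms. -/

theorem BanditInstance.bestArm_eq (P : BanditInstance K) {a : Fin K}
    (h : ∀ b, b ≠ a → P.mean b < P.mean a) : P.bestArm = a := by
  by_contra hne
  exact (h _ hne).asymm (P.mean_lt_mean_bestArm (Ne.symm hne))

theorem pi_gaussianReal_map_eval (m : Fin K → ℝ) (v : Fin K → NNReal) (a : Fin K) :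
    (Measure.pi fun b => gaussianReal (m b) (v b)).map (fun y => y a)
      = gaussianReal (m a) (v a) :=
  (measurePreserving_eval (fun b => gaussianReal (m b) (v b)) a).map_eq

theorem integral_pi_gaussianReal_eval (m : Fin K → ℝ) (v : Fin K → NNReal) (a : Fin K) :
    ∫ y, y a ∂(Measure.pi fun b => gaussianReal (m b) (v b)) = m a := by
  rw [← integral_id_gaussianReal (μ := m a) (v := v a), ← pi_gaussianReal_map_eval m v a]
  exact (integral_map (φ := fun y : Fin K → ℝ => y a) (f := fun x => x)
    (measurable_pi_apply a).aemeasurable aestronglyMeasurable_id).symm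

theorem integrable_pi_gaussianReal_eval (m : Fin K → ℝ) (v : Fin K → NNReal) (a : Fin K) :
    Integrable (fun y : Fin K → ℝ => y a) (Measure.pi fun b => gaussianReal (m b) (v b)) := by
  have h : Integrable id (gaussianReal (m a) (v a)) := IsGaussian.integrable_id
  exact (measurePreserving_eval (fun b => gaussianReal (m b) (v b)) a).integrable_comp_of_integrable h

/-- The instance with independent Gaussian outcomes of means `m` and standard deviations `σ`. -/
noncomputable def gaussianInstance (σ m : Fin K → ℝ) (a : Fin K)
    (h : ∀ b, b ≠ a → m b < m a) : BanditInstance K where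
  law := Measure.pi fun b => gaussianReal (m b) (Real.toNNReal (σ b ^ 2))
  isProbabilityMeasure := inferInstance
  integrable := integrable_pi_gaussianReal_eval m _
  exists_best := ⟨a, fun b hb => by
    simpa only [integral_pi_gaussianReal_eval] using h b hb⟩

theorem mean_gaussianInstance (σ m : Fin K → ℝ) (a : Fin K) (h : ∀ b, b ≠ a → m b < m a)
    (b : Fin K) : (gaussianInstance σ m a h).mean b = m b :=
  integral_pi_gaussianReal_eval m _ b

theorem bestArm_gaussianInstance (σ m : Fin K → ℝ) (a : Fin K) (h : ∀ b, b ≠ a → m b < m a) :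
    (gaussianInstance σ m a h).bestArm = a :=
  BanditInstance.bestArm_eq _ fun b hb => by simpa only [mean_gaussianInstance] using h b hb

theorem gaussianInstance_mem_gaussianClass (σ m : Fin K → ℝ) (a : Fin K)
    (h : ∀ b, b ≠ a → m b < m a) : gaussianInstance σ m a h ∈ gaussianClass σ := by
  refine ⟨?_, fun b => ?_⟩
  · have hi : iIndepFun (fun (b : Fin K) (y : Fin K → ℝ) => y b)
        (gaussianInstance σ m a h).law :=
      iIndepFun_pi (μ := fun b => gaussianReal (m b) (Real.toNNReal (σ b ^ 2)))
        (X := fun _ x => x) fun _ => aemeasurable_id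
    have hl : ∀ b, HasGaussianLaw (fun y : Fin K → ℝ => y b) (gaussianInstance σ m a h).law :=
      fun b => ⟨by
        rw [gaussianInstance, pi_gaussianReal_map_eval]; infer_instance⟩
    have := (hi.hasGaussianLaw hl).isGaussian_map
    rwa [show (fun y : Fin K → ℝ => (y ·)) = id from rfl, Measure.map_id] at this
  · rw [mean_gaussianInstance]
    exact pi_gaussianReal_map_eval m _ b

/-- The log-likelihood ratio between the normal laws with means `p` and `q` and variance `v`. -/
noncomputable def gaussianLLR (p q v x : ℝ) : ℝ := ((p - q) * (2 * x - p - q)) / (2 * v)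

theorem measurable_gaussianLLR (p q v : ℝ) : Measurable (gaussianLLR p q v) := by
  unfold gaussianLLR; fun_prop

theorem gaussianReal_eq_withDensity (p q : ℝ) {v : ℝ} (hv : 0 < v) :
    gaussianReal p v.toNNReal = (gaussianReal q v.toNNReal).withDensity
      fun x => ENNReal.ofReal (Real.exp (gaussianLLR p q v x)) := by
  have hv' : v.toNNReal ≠ 0 := (Real.toNNReal_pos.2 hv).ne'
  have hm : Measurable fun x => ENNReal.ofReal (Real.exp (gaussianLLR p q v x)) :=
    (Real.measurable_exp.comp (measurable_gaussianLLR p q v)).ennreal_ofReal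
  rw [gaussianReal_of_var_ne_zero _ hv', gaussianReal_of_var_ne_zero _ hv',
    ← withDensity_mul _ (measurable_gaussianPDF _ _) hm]
  congr 1
  ext1 x
  rw [Pi.mul_apply, gaussianPDF, gaussianPDF, ← ENNReal.ofReal_mul (gaussianPDFReal_nonneg _ _ _),
    gaussianPDFReal, gaussianPDFReal, mul_assoc _ (Real.exp _) (Real.exp _), ← Real.exp_add, Real.coe_toNNReal _ hv.le]
  congr 3
  unfold gaussianLLR
  field_simp
  ring

/-- The log-likelihood ratio is affine in the outcome, so only the mean matters; for `v > 0` the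
value is minus a Gaussian Kullback–Leibler divergence. -/
theorem integral_gaussianLLR (σ m : Fin K → ℝ) (a : Fin K) (h : ∀ b, b ≠ a → m b < m a)
    (p v : ℝ) (b : Fin K) :
    Integrable (fun y => gaussianLLR p (m b) v (y b)) (gaussianInstance σ m a h).law ∧
      ∫ y, gaussianLLR p (m b) v (y b) ∂(gaussianInstance σ m a h).law
        = -((p - m b) ^ 2 / (2 * v)) := by
  have hi := (gaussianInstance σ m a h).integrable b
  have e : (fun y : Fin K → ℝ => gaussianLLR p (m b) v (y b))
      = fun y => (p - m b) / v * y b + (p - m b) * (-p - m b) / (2 * v) := by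
    ext y; unfold gaussianLLR
    rcases eq_or_ne v 0 with rfl | hv
    · simp
    · field_simp; ring
  rw [e]
  refine ⟨(hi.const_mul _).add (integrable_const _), ?_⟩
  rw [integral_add (hi.const_mul _) (integrable_const _), integral_const_mul]
  have hm : ∫ y, y b ∂(gaussianInstance σ m a h).law = m b := mean_gaussianInstance σ m a h b
  rw [hm]
  rcases eq_or_ne v 0 with rfl | hv
  · simp
  · simp; field_simp; ring

/-- The transportation inequality for Gaussian instances with independent arms. -/
theorem errorExponent_gaussianInstance_le {σ : Fin K → ℝ} (hσ : ∀ a, 0 < σ a)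
    {π : Strategy K} {p q : Fin K → ℝ} {a b : Fin K} (hp : ∀ c, c ≠ a → p c < p a)
    (hq : ∀ c, c ≠ b → q c < q b) (hab : b ≠ a) {w : Fin K → ℝ}
    (hw : ∀ c, Tendsto (fun T => allocRatio π (gaussianInstance σ q b hq) T c) atTop (𝓝 (w c)))
    (hcons : Tendsto (fun T : ℕ => (gaussianInstance σ q b hq).seqLaw
      {ω | π.recommended T ω = (gaussianInstance σ q b hq).bestArm}) atTop (𝓝 1)) :
    errorExponent π (gaussianInstance σ p a hp)
      ≤ ((∑ c, w c * ((p c - q c) ^ 2 / (2 * σ c ^ 2)) : ℝ) : EReal) := by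
  have key := errorExponent_le (P := gaussianInstance σ p a hp)
    (by simpa only [bestArm_gaussianInstance] using hab) hw hcons
    (ℓ := fun c => gaussianLLR (p c) (q c) (σ c ^ 2)) (fun c => measurable_gaussianLLR _ _ _)
    (fun c => (integral_gaussianLLR σ q b hq _ _ c).1) (fun c => by
      rw [gaussianInstance, gaussianInstance, pi_gaussianReal_map_eval, pi_gaussianReal_map_eval]
      exact gaussianReal_eq_withDensity _ _ (pow_pos (hσ c) 2))
  simpa only [(integral_gaussianLLR σ q b hq _ _ _).2, neg_neg] using key

/-! ### The cheapest alternative to the equal-gap instance. -/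

theorem pairVariance_pos {σ w : Fin K → ℝ} (hσ : ∀ a, 0 < σ a) (hw : ∀ a, 0 < w a)
    (a b : Fin K) : 0 < pairVariance σ w a b :=
  add_pos (div_pos (pow_pos (hσ a) 2) (hw a)) (div_pos (pow_pos (hσ b) 2) (hw b))

/-- The mean vector `0` at `a`, `-Δ` elsewhere. -/
noncomputable def slopeMean (a : Fin K) (Δ : ℝ) : Fin K → ℝ := fun c => if c = a then 0 else -Δ

theorem slopeMean_lt {a : Fin K} {Δ : ℝ} (hΔ : 0 < Δ) (c : Fin K) (hc : c ≠ a) :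
    slopeMean a Δ c < slopeMean a Δ a := by
  simp [slopeMean, hc, hΔ]

theorem errorExponent_slopeMean_le {σ : Fin K → ℝ} (hσ : ∀ a, 0 < σ a) {Δ : ℝ} (hΔ : 0 < Δ)
    {M : Set (BanditInstance K)} (hM : gaussianClass σ ⊆ M) {π : Strategy K}
    (hcons : IsConsistent M π) {w : Fin K → ℝ} (hw0 : ∀ c, 0 < w c)
    (hw : ∀ P ∈ M, ∀ c, Tendsto (fun T : ℕ => allocRatio π P T c) atTop (𝓝 (w c)))
    {a b : Fin K} (hab : b ≠ a) :
    errorExponent π (gaussianInstance σ (slopeMean a Δ) a (slopeMean_lt hΔ))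
      ≤ ((Δ ^ 2 / (2 * pairVariance σ w a b) : ℝ) : EReal) := by
  have hΩ := pairVariance_pos hσ hw0 a b
  -- At the optimum itself `a` and `b` would tie and no best arm would exist; the slack `ε` breaks
  -- the tie and is sent to `0`.
  have hlim : Tendsto (fun ε : ℝ => (((Δ + ε) ^ 2 / (2 * pairVariance σ w a b) : ℝ) : EReal))
      (𝓝[>] 0) (𝓝 ((Δ ^ 2 / (2 * pairVariance σ w a b) : ℝ) : EReal)) := by
    refine (continuous_coe_real_ereal.tendsto _).comp (tendsto_nhdsWithin_of_tendsto_nhds ?_)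
    have : Continuous fun ε : ℝ => (Δ + ε) ^ 2 / (2 * pairVariance σ w a b) := by fun_prop
    simpa using this.tendsto 0
  refine ge_of_tendsto hlim ?_
  filter_upwards [self_mem_nhdsWithin] with ε hε
  have hε : 0 < ε := hε
  set Ω := pairVariance σ w a b with hΩd
  -- `x` and `y` minimise `w a * x ^ 2 / (2 * σ a ^ 2) + w b * y ^ 2 / (2 * σ b ^ 2)` subject to `x
  -- + y = Δ + ε`.
  set x := (Δ + ε) * (σ a ^ 2 / w a) / Ω with hx
  set y := (Δ + ε) * (σ b ^ 2 / w b) / Ω with hy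
  have hσa := hσ a
  have hσb := hσ b
  have hwa := hw0 a
  have hwb := hw0 b
  have hy0 : 0 < y := by positivity
  have hxy : x + y = Δ + ε := by
    rw [hx, hy, ← add_div, ← mul_add]
    exact mul_div_cancel_right₀ _ hΩ.ne'
  -- Arm `b` beats `a` because `x + y > Δ`, and the arms left at `-Δ` because `y > 0`.
  set q : Fin K → ℝ := fun c => if c = a then -x else if c = b then -Δ + y else -Δ with hq
  have hqb : ∀ c, c ≠ b → q c < q b := by
    intro c hc
    by_cases hca : c = a
    · simp only [hq, hca, hab, if_true, if_false]; linarith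
    · simp only [hq, hca, hab, hc, if_true, if_false]; linarith
  have hqM := hM (gaussianInstance_mem_gaussianClass σ q b hqb)
  refine (errorExponent_gaussianInstance_le hσ (slopeMean_lt hΔ) hqb hab (hw _ hqM)
    (hcons _ hqM)).trans (le_of_eq ?_)
  congr 1
  rw [← Finset.sum_subset (Finset.subset_univ {a, b}), Finset.sum_pair hab.symm]
  · simp only [slopeMean, hq, hab, if_true, if_false]
    have e1 : w a * ((0 - -x) ^ 2 / (2 * σ a ^ 2)) = (Δ + ε) ^ 2 * (σ a ^ 2 / w a) / (2 * Ω ^ 2) := by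
      rw [hx]; field_simp; ring
    have e2 : w b * ((-Δ - (-Δ + y)) ^ 2 / (2 * σ b ^ 2))
        = (Δ + ε) ^ 2 * (σ b ^ 2 / w b) / (2 * Ω ^ 2) := by
      rw [hy]; field_simp; ring
    rw [e1, e2, ← add_div, ← mul_add]
    have e3 : σ a ^ 2 / w a + σ b ^ 2 / w b = Ω := rfl
    rw [e3]; field_simp
  · intro c _ hc
    simp only [Finset.mem_insert, Finset.mem_singleton, not_or] at hc
    simp [slopeMean, hq, hc.1, hc.2]

/-! ### Existence of the maximum over the open simplex. -/

theorem worstPair_le {σ w : Fin K → ℝ} {Δ : ℝ} {a b : Fin K} (hab : b ≠ a) :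
    worstPair σ Δ w ≤ Δ ^ 2 / (2 * pairVariance σ w a b) :=
  (ciInf_le (Set.finite_range _).bddBelow a).trans
    (ciInf_le (Set.finite_range _).bddBelow (⟨b, hab⟩ : {c : Fin K // c ≠ a}))

theorem exists_worstPair_eq (hK : 2 ≤ K) (σ : Fin K → ℝ) (Δ : ℝ) (w : Fin K → ℝ) :
    ∃ a b : Fin K, b ≠ a ∧ worstPair σ Δ w = Δ ^ 2 / (2 * pairVariance σ w a b) := by
  have : Nontrivial (Fin K) := Fin.nontrivial_iff_two_le.2 hK
  obtain ⟨a, ha⟩ := exists_eq_ciInf_of_finite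
    (f := fun a : Fin K => ⨅ b : {b : Fin K // b ≠ a}, Δ ^ 2 / (2 * pairVariance σ w a b))
  obtain ⟨c, hc⟩ := exists_ne a
  have : Nonempty {b : Fin K // b ≠ a} := ⟨⟨c, hc⟩⟩
  obtain ⟨b, hb⟩ := exists_eq_ciInf_of_finite
    (f := fun b : {b : Fin K // b ≠ a} => Δ ^ 2 / (2 * pairVariance σ w a b))
  exact ⟨a, b, b.2, (hb.trans ha).symm⟩

/-- Dropping the other arm's term from the variance shows that the objective vanishes as any
coordinate tends to `0`, which keeps maximisers off the boundary. -/
theorem worstPair_le_mul (hK : 2 ≤ K) {σ w : Fin K → ℝ} (hσ : ∀ a, 0 < σ a)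
    (hw : ∀ a, 0 < w a) (Δ : ℝ) (a : Fin K) :
    worstPair σ Δ w ≤ Δ ^ 2 / (2 * σ a ^ 2) * w a := by
  have : Nontrivial (Fin K) := Fin.nontrivial_iff_two_le.2 hK
  obtain ⟨b, hb⟩ := exists_ne a
  have hσa := hσ a
  have hwa := hw a
  calc worstPair σ Δ w ≤ Δ ^ 2 / (2 * pairVariance σ w a b) := worstPair_le hb
    _ ≤ Δ ^ 2 / (2 * (σ a ^ 2 / w a)) := by
        gcongr
        exact le_add_of_nonneg_right (div_pos (pow_pos (hσ b) 2) (hw b)).le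
    _ = Δ ^ 2 / (2 * σ a ^ 2) * w a := by field_simp

theorem worstPair_pos (hK : 2 ≤ K) {σ w : Fin K → ℝ} (hσ : ∀ a, 0 < σ a)
    (hw : ∀ a, 0 < w a) {Δ : ℝ} (hΔ : 0 < Δ) : 0 < worstPair σ Δ w := by
  obtain ⟨a, b, -, h⟩ := exists_worstPair_eq hK σ Δ w
  rw [h]
  have := pairVariance_pos hσ hw a b
  positivity

theorem continuousOn_iInf_of_finite {ι X : Type*} [Finite ι] [Nonempty ι] [TopologicalSpace X]
    {f : ι → X → ℝ} {s : Set X} (hf : ∀ i, ContinuousOn (f i) s) :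
    ContinuousOn (fun x => ⨅ i, f i x) s := by
  have := Fintype.ofFinite ι
  simp only [← Finset.inf'_univ_eq_ciInf]
  exact ContinuousOn.finset_inf'_apply _ fun i _ => hf i

theorem continuousOn_worstPair (hK : 2 ≤ K) {σ : Fin K → ℝ} (hσ : ∀ a, 0 < σ a) (Δ : ℝ) :
    ContinuousOn (worstPair σ Δ) {w | ∀ a, 0 < w a} := by
  have : Nontrivial (Fin K) := Fin.nontrivial_iff_two_le.2 hK
  refine continuousOn_iInf_of_finite fun a => ?_
  obtain ⟨c, hc⟩ := exists_ne a
  have : Nonempty {b : Fin K // b ≠ a} := ⟨⟨c, hc⟩⟩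
  refine continuousOn_iInf_of_finite fun b => ?_
  have hd : ∀ c : Fin K, ContinuousOn (fun w : Fin K → ℝ => σ c ^ 2 / w c) {w | ∀ a, 0 < w a} :=
    fun c => continuousOn_const.div (continuous_apply c).continuousOn fun w hw => (hw c).ne'
  exact continuousOn_const.div (continuousOn_const.mul ((hd a).add (hd b)))
    fun w hw => (mul_pos two_pos (pairVariance_pos hσ hw a b)).ne'

theorem isGreatest_lowerBound (hK : 2 ≤ K) {σ : Fin K → ℝ} (hσ : ∀ a, 0 < σ a) {Δ : ℝ}
    (hΔ : 0 < Δ) : IsGreatest (worstPair σ Δ '' allocSimplex K) (lowerBound σ Δ) := by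
  suffices h : ∃ w ∈ allocSimplex K, ∀ w' ∈ allocSimplex K, worstPair σ Δ w' ≤ worstPair σ Δ w by
    obtain ⟨w, hw, hmax⟩ := h
    have hg : IsGreatest (worstPair σ Δ '' allocSimplex K) (worstPair σ Δ w) :=
      ⟨⟨w, hw, rfl⟩, by rintro _ ⟨w', hw', rfl⟩; exact hmax w' hw'⟩
    rwa [lowerBound, hg.csSup_eq]
  have : Nontrivial (Fin K) := Fin.nontrivial_iff_two_le.2 hK
  have hK2 : (2 : ℝ) ≤ K := by exact_mod_cast hK
  set u : Fin K → ℝ := fun _ => (K : ℝ)⁻¹ with hu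
  have hu0 : ∀ a, 0 < u a := fun _ => inv_pos.2 (by linarith)
  set v := worstPair σ Δ u with hv
  have hv0 : 0 < v := worstPair_pos hK hσ hu0 hΔ
  -- A compact part of the simplex with all coordinates positive. By `worstPair_le_mul`, points of
  -- the open simplex outside `S` have value below `v`, the value at the uniform allocation, which
  -- lies in `S`.
  set S : Set (Fin K → ℝ) :=
    stdSimplex ℝ (Fin K) ∩ {w | ∀ a, v ≤ Δ ^ 2 / (2 * σ a ^ 2) * w a} with hS
  have hcoef : ∀ a, 0 < Δ ^ 2 / (2 * σ a ^ 2) := fun a => by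
    have := hσ a
    positivity
  have hSpos : ∀ w ∈ S, ∀ a, 0 < w a := fun w hw a =>
    pos_of_mul_pos_right (hv0.trans_le (hw.2 a)) (hcoef a).le
  have hcl : IsClosed {w : Fin K → ℝ | ∀ a, v ≤ Δ ^ 2 / (2 * σ a ^ 2) * w a} := by
    rw [Set.ofPred_forall]
    exact isClosed_iInter fun a =>
      isClosed_le continuous_const (continuous_const.mul (continuous_apply a))
  have hSc : IsCompact S := (isCompact_stdSimplex ℝ (Fin K)).inter_right hcl
  have huS : u ∈ S := by
    refine ⟨⟨fun a => (hu0 a).le, ?_⟩, fun a => worstPair_le_mul hK hσ hu0 Δ a⟩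
    have : (K : ℝ) ≠ 0 := by linarith
    simp [hu, this]
  obtain ⟨w, hwS, hwmax⟩ := hSc.exists_isMaxOn ⟨u, huS⟩
    ((continuousOn_worstPair hK hσ Δ).mono hSpos)
  have hw0 := hSpos w hwS
  refine ⟨w, ⟨fun a => ⟨hw0 a, ?_⟩, hwS.1.2⟩, fun w' hw' => ?_⟩
  · obtain ⟨b, hb⟩ := exists_ne a
    have h1 : w a + w b ≤ ∑ c, w c := by
      rw [← Finset.sum_pair hb.symm]
      exact Finset.sum_le_sum_of_subset_of_nonneg (Finset.subset_univ _)
        fun c _ _ => (hw0 c).le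
    linarith [hw0 b, hwS.1.2]
  · by_cases h : w' ∈ S
    · exact hwmax h
    · have h2 : ∃ a, Δ ^ 2 / (2 * σ a ^ 2) * w' a < v := by
        by_contra hcon
        push Not at hcon
        exact h ⟨⟨fun a => (hw'.1 a).1.le, hw'.2⟩, hcon⟩
      obtain ⟨a, ha⟩ := h2
      exact ((worstPair_le_mul hK hσ (fun c => (hw'.1 c).1) Δ a).trans ha.le).trans (hwmax huS)

/-! ### The hard instance and the conclusion. -/

theorem gaussianInstance_slopeMean_mem_gaussianModel (σ : Fin K → ℝ) (a : Fin K) {Δl Δu : ℝ}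
    (hΔ : Δl ≤ Δu) (hΔu : 0 < Δu) :
    gaussianInstance σ (slopeMean a Δu) a (slopeMean_lt hΔu) ∈ gaussianModel σ a Δl Δu :=
  ⟨gaussianInstance_mem_gaussianClass _ _ _ _, bestArm_gaussianInstance _ _ _ _, fun c hc => by
    simp [mean_gaussianInstance, slopeMean, hc, hΔ]⟩

end FixedBudgetBAI

theorem mainTheorem7 {K : ℕ} (hK : 2 ≤ K) (σ : Fin K → ℝ) (hσ : ∀ a, 0 < σ a)
    (Δl Δu : ℝ) (hΔl : 0 < Δl) (hΔ : Δl ≤ Δu)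
    (M : Set (BanditInstance K)) (hM : gaussianClass σ ⊆ M)
    (π : Strategy K) (hcons : IsConsistent M π) (hinv : IsAsympInvariant M π) :
    IsGreatest (worstPair σ Δu '' allocSimplex K) (lowerBound σ Δu) ∧
      (⨅ P ∈ ⋃ aStar : Fin K, gaussianModel σ aStar Δl Δu, errorExponent π P)
        ≤ ((lowerBound σ Δu : ℝ) : EReal) := by
  have hΔu := hΔl.trans_le hΔ
  have hg := isGreatest_lowerBound hK hσ hΔu
  refine ⟨hg, ?_⟩
  -- Invariance fixes `w` before any instance is chosen, so the hard pair `(a, b)` may depend on it.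
  obtain ⟨w, hw, hwlim⟩ := hinv
  obtain ⟨a, b, hab, hmin⟩ := exists_worstPair_eq hK σ Δu w
  calc (⨅ P ∈ ⋃ aStar : Fin K, gaussianModel σ aStar Δl Δu, errorExponent π P)
      ≤ errorExponent π (gaussianInstance σ (slopeMean a Δu) a (slopeMean_lt hΔu)) :=
        iInf₂_le _ (Set.mem_iUnion.2
          ⟨a, gaussianInstance_slopeMean_mem_gaussianModel σ a hΔ hΔu⟩)
    _ ≤ ((Δu ^ 2 / (2 * pairVariance σ w a b) : ℝ) : EReal) :=
        errorExponent_slopeMean_le hσ hΔu hM hcons (fun c => (hw.1 c).1) hwlim hab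
    _ ≤ ((lowerBound σ Δu : ℝ) : EReal) := by
        rw [← hmin]
        exact EReal.coe_le_coe_iff.2 (hg.2 ⟨w, hw, rfl⟩)
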